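/- Let $f:[0,1]\to[0,1]$ be Borel measurable. Under $P_f$ the data $(X_i,Y_i)_{i\ge 1}$ are i.i.d., with $X_i$ uniform on $[0,1]$ and $Y_i\in\{0,1\}$, given $X_i=x$, Bernoulli with success probability $f(x)$; write $(\mathbf X,\mathbf Y)_n$ for the first $n$ pairs. A vector $\mathbf u\in[0,1]^m$ of (unordered) split points divides $[0,1]$ into cells $J_0(\mathbf u),\dots,J_m(\mathbf u)$; for $\mathbf w\in[0,1]^{m+1}$ let $g_{\mathbf u,\mathbf w}$ be the step function with value $w_i$ on $J_i(\mathbf u)$. For a data set $(\mathbf x,\mathbf y)$ let $N_i^S$ and $N_i^F$ be the numbers of data points with covariate in $J_i(\mathbf u)$ and response $1$, respectively $0$, and put $$L_{\mathbf u}(\mathbf w)=\prod_{i=0}^m w_i^{N_i^S}(1-w_i)^{N_i^F},\qquad Z_{\mathbf u}(\mathbf x,\mathbf y)=\int_{[0,1]^{m+1}}L_{\mathbf u}(\mathbf w)\,d\mathbf w,\qquad Z_m(\mathbf x,\mathbf y)=\int_{[0,1]^m}Z_{\mathbf u}(\mathbf x,\mathbf y)\,d\mathbf u .$$ Let $Q_{\mathbf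 u}(\cdot\mid(\mathbf x,\mathbf y))$ be the law of $g_{\mathbf u,\mathbf w}$ when $\mathbf w$ has density $L_{\mathbf u}/Z_{\mathbf u}(\mathbf x,\mathbf y)$ on $[0,1]^{m+1}$, and let $$Q_m(\cdot\mid(\mathbf x,\mathbf y))=\frac1{Z_m(\mathbf x,\mathbf y)}\int_{[0,1]^m}Q_{\mathbf u}(\cdot\mid(\mathbf x,\mathbf y))\,Z_{\mathbf u}(\mathbf x,\mathbf y)\,d\mathbf u ,$$ the posterior for the prior under which the $m$ split points and the $m+1$ step heights are independent and uniform on $[0,1]$. Finally let $H(f)=\int_0^1\bigl(-f\log f-(1-f)\log(1-f)\bigr)\,dx$ (with $0\log 0=0$) and let $\|\cdot\|_1$ be the norm of $L^1[0,1]$. Corollary 4. For each $\delta>0$ there exist $\varepsilon>0$, $K<\infty$ and $n_0$ (depending only on $f$ and $\delta$) such that for all $n\ge n_0$ and all integers $m$ with $K\le m\le\varepsilon n$, with $P_f$-probability at least $1-\delta$ both $$Q_m\bigl(\{g:\|g-f\|_1\ge\delta\}\mid(\mathbf X,\mathbf Y)_n\bigr)<\delta\qquad\text{and}\qquad\bigl|n^{-1}\log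 Z_m((\mathbf X,\mathbf Y)_n)+H(f)\bigr|<\delta .$$ -/

import Mathlib

open MeasureTheory ProbabilityTheory

noncomputable section

namespace BinaryRegression

/-- `(X i, Y i)`, `i = 0, 1, 2, …`, is a data stream with law `P_f`: the pairs are i.i.d., the
covariate `X i` is uniform on `[0,1]`, and given `X i` the response `Y i` is Bernoulli with
success probability `f (X i)`. Responses are Booleans, `true` being a success. -/
structure IsDataStream {Ω : Type*} [MeasurableSpace Ω] (P : Measure Ω)
    (f : unitInterval → unitInterval) (X : ℕ → Ω → unitInterval) (Y : ℕ → Ω → Bool) : Prop where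
  measurable_X : ∀ i, Measurable (X i)
  measurable_Y : ∀ i, Measurable (Y i)
  indep : iIndepFun (fun i ω => (X i ω, Y i ω)) P
  law_X : ∀ i, P.map (X i) = volume
  cond_Y : ∀ i, P⟦{ω | Y i ω = true} | MeasurableSpace.comap (X i) inferInstance⟧
    =ᵐ[P] fun ω => (f (X i ω) : ℝ)

/-- The first `n` observations of a data stream. -/
def sample {Ω : Type*} (X : ℕ → Ω → unitInterval) (Y : ℕ → Ω → Bool) (n : ℕ) (ω : Ω) :
    Fin n → unitInterval × Bool :=
  fun i => (X i ω, Y i ω)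

/-- The index of the cell that contains `x`, in the partition of `[0,1]` induced by the
(unordered) split points `u`: the number of split points strictly to the left of `x`. With
`u₍₁₎ ≤ … ≤ u₍ₘ₎` the ordered split points, the cells are `[0, u₍₁₎]`, `(u₍₁₎, u₍₂₎]`, …,
`(u₍ₘ₎, 1]`. -/
def cellIndex {m : ℕ} (u : Fin m → unitInterval) (x : unitInterval) : Fin (m + 1) :=
  ⟨(Finset.univ.filter fun j => u j < x).card,
    Nat.lt_succ_of_le ((Finset.card_filter_le _ _).trans (Finset.card_fin m).le)⟩

/-- The step function with split points `u` and value `w i` on the `i`-th cell. -/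
def stepFun {m : ℕ} (u : Fin m → unitInterval) (w : Fin (m + 1) → unitInterval) :
    unitInterval → unitInterval :=
  fun x => w (cellIndex u x)

/-- The number of observations with response `b` and covariate in the `i`-th cell: `N_i^S` for
`b = true`, `N_i^F` for `b = false`. -/
def cellCount {m n : ℕ} (u : Fin m → unitInterval) (d : Fin n → unitInterval × Bool) (b : Bool)
    (i : Fin (m + 1)) : ℕ :=
  (Finset.univ.filter fun k => cellIndex u (d k).1 = i ∧ (d k).2 = b).card

/-- The likelihood `∏_i w_i ^ N_i^S (1 - w_i) ^ N_i^F` of the step heights `w`. -/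
def likelihood {m n : ℕ} (u : Fin m → unitInterval) (d : Fin n → unitInterval × Bool)
    (w : Fin (m + 1) → unitInterval) : ℝ :=
  ∏ i, (w i : ℝ) ^ cellCount u d true i * (1 - (w i : ℝ)) ^ cellCount u d false i

/-- The `Q_u`-predictive probability `Z_u`: the integral of the likelihood against the prior
`π_u`, under which the step heights are independent and uniform on `[0,1]`. -/
def splitPredictive {m n : ℕ} (u : Fin m → unitInterval) (d : Fin n → unitInterval × Bool) : ℝ :=
  ∫ w : Fin (m + 1) → unitInterval, likelihood u d w

/-- The `Q_u`-posterior, as the distribution of the vector of step heights: its density with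
respect to Lebesgue measure on the cube is the likelihood divided by `Z_u`. -/
def splitPosterior {m n : ℕ} (u : Fin m → unitInterval) (d : Fin n → unitInterval × Bool) :
    Measure (Fin (m + 1) → unitInterval) :=
  volume.withDensity fun w => ENNReal.ofReal (likelihood u d w / splitPredictive u d)

/-- The `Q_m`-predictive probability `Z_m = ∫ Z_u du`, the integral being over the cube of all
split point vectors of length `m`. -/
def predictive (m : ℕ) {n : ℕ} (d : Fin n → unitInterval × Bool) : ℝ :=
  ∫ u : Fin m → unitInterval, splitPredictive u d

/-- The mass `Q_m(A | d) = (∫ Q_u(A | d) Z_u du) / Z_m` that the `Q_m`-posterior, given the data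
`d`, gives to a set `A` of functions. -/
def posteriorMass (m : ℕ) {n : ℕ} (d : Fin n → unitInterval × Bool)
    (A : Set (unitInterval → unitInterval)) : ENNReal :=
  (∫⁻ u : Fin m → unitInterval,
      splitPosterior u d {w | stepFun u w ∈ A} * ENNReal.ofReal (splitPredictive u d))
    / ENNReal.ofReal (predictive m d)

/-- The distance `‖g - f‖₁` in `L¹[0,1]`. -/
def l1Dist (g f : unitInterval → unitInterval) : ℝ :=
  ∫ x, |(g x : ℝ) - (f x : ℝ)|

/-- The entropy functional `H(f) = ∫ H(f(x)) dx`, `H` being the Shannon entropy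
`H(p) = - p log p - (1 - p) log (1 - p)`. -/
def entropy (f : unitInterval → unitInterval) : ℝ :=
  ∫ x, Real.binEntropy (f x : ℝ)

end BinaryRegression

end

/-! Everything follows from two exponential estimates, each holding with high probability: a
likelihood bound for all step functions at once (`exists_likelihood_bound`) and a lower bound on
`Z_m` (`exists_predictive_ge`). Integrating the first bounds `Z_m` from above, and its `L¹` term
divided by the second bounds the posterior mass far from `f`.

Upper bound. On a grid with mesh `1 / (r m)` the cells hit by split points have total length at most
`1 / r`. Elsewhere the square root of the likelihood function is constant on cells and can be
rounded up to a multiple of `1 / r`. So `exp (O(m))` brackets `V` cover all step functions, and for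
`m ≤ ε n` a union bound can afford them. With `q` the likelihood function of `f`, truncated away
from zero, the likelihood is at most `(∏ V / √q) ^ 2 * ∏ q`. The mean of `V / √q` is nearly bounded
by a Hellinger affinity, hence by `1 - D ^ 2 / 4` with `D` the `L¹` distance, and Markov's
inequality controls the product. Chebyshev's inequality gives `∏ q ≲ exp (-n H(f))`.

Lower bound. Some continuous `g`, bounded away from `0` and `1`, has expected log-likelihood close
to `-H(f)`. Split points that meet each of `L` equal intervals have prior mass at least `L ^ (-L)`,
whatever `m` is. Given these, heights near `g` have mass `κ ^ (m + 1)`, which is negligible on the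
scale `exp (-n)` when `m ≤ ε n`. -/

namespace BinaryRegression

/-! ### Likelihood, predictive probability and posterior mass -/

/-- The probability that a Bernoulli variable with success probability `p` takes the value `b`. -/
noncomputable def bern (p : unitInterval) (b : Bool) : ℝ := if b then (p : ℝ) else 1 - p

@[simp] lemma bern_true (p : unitInterval) : bern p true = p := by simp [bern]

@[simp] lemma bern_false (p : unitInterval) : bern p false = 1 - p := by simp [bern]

lemma bern_nonneg (p : unitInterval) (b : Bool) : 0 ≤ bern p b := by
  cases b <;> simp [p.2.1, p.2.2]

lemma bern_le_one (p : unitInterval) (b : Bool) : bern p b ≤ 1 := by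
  cases b <;> simp [p.2.1, p.2.2]

lemma continuous_bern (b : Bool) : Continuous fun p => bern p b := by
  cases b <;> simp <;> fun_prop

lemma measurable_of_bool_slices {α β : Type*} [MeasurableSpace α] [MeasurableSpace β]
    {h : α × Bool → β} (hh : ∀ b, Measurable fun x => h (x, b)) : Measurable h :=
  measurable_from_prod_countable_left hh

/-- The likelihood is the product over the observations of the probabilities of the responses. -/
lemma likelihood_eq_prod {m n : ℕ} (u : Fin m → unitInterval) (d : Fin n → unitInterval × Bool)
    (w : Fin (m + 1) → unitInterval) :
    likelihood u d w = ∏ k, bern (stepFun u w (d k).1) (d k).2 := by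
  unfold likelihood
  rw [← Finset.prod_fiberwise Finset.univ (fun k => cellIndex u (d k).1)]
  refine Finset.prod_congr rfl fun i _ => ?_
  rw [← Finset.prod_filter_mul_prod_filter_not _ (fun k => (d k).2 = true),
    Finset.filter_filter, Finset.filter_filter]
  congr 1
  · rw [Finset.prod_congr rfl (g := fun _ => (w i : ℝ)), Finset.prod_const]
    · rfl
    · intro k hk
      simp only [Finset.mem_filter] at hk
      simp [stepFun, hk.2.1, hk.2.2]
  · rw [Finset.prod_congr rfl (g := fun _ => 1 - (w i : ℝ)), Finset.prod_const]
    · simp [cellCount]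
    · intro k hk
      simp only [Finset.mem_filter, Bool.not_eq_true] at hk
      simp [stepFun, hk.2.1, hk.2.2]

lemma likelihood_nonneg {m n : ℕ} (u : Fin m → unitInterval) (d : Fin n → unitInterval × Bool)
    (w : Fin (m + 1) → unitInterval) : 0 ≤ likelihood u d w := by
  rw [likelihood_eq_prod]
  exact Finset.prod_nonneg fun _ _ => bern_nonneg _ _

lemma likelihood_le_one {m n : ℕ} (u : Fin m → unitInterval) (d : Fin n → unitInterval × Bool)
    (w : Fin (m + 1) → unitInterval) : likelihood u d w ≤ 1 := by
  rw [likelihood_eq_prod]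
  exact Finset.prod_le_one (fun _ _ => bern_nonneg _ _) fun _ _ => bern_le_one _ _

lemma measurable_cellIndex {m : ℕ} :
    Measurable fun p : (Fin m → unitInterval) × unitInterval => cellIndex p.1 p.2 := by
  have h : Measurable fun p : (Fin m → unitInterval) × unitInterval =>
      (cellIndex p.1 p.2 : ℕ) := by
    simp only [cellIndex, Finset.card_filter]
    refine Finset.measurable_fun_sum _ fun j _ => ?_
    refine Measurable.ite ?_ measurable_const measurable_const
    exact measurableSet_lt (by fun_prop) (by fun_prop)
  refine measurable_to_countable' fun i => ?_
  convert h (measurableSet_singleton (i : ℕ)) using 1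
  ext p
  simp [Fin.ext_iff]

lemma measurable_stepFun_joint {m : ℕ} (x : unitInterval) :
    Measurable fun p : (Fin m → unitInterval) × (Fin (m + 1) → unitInterval) =>
      stepFun p.1 p.2 x := by
  have h : Measurable fun p : (Fin (m + 1) → unitInterval) × Fin (m + 1) => p.1 p.2 :=
    measurable_from_prod_countable_left fun i => measurable_pi_apply i
  have hc : Measurable fun p : (Fin m → unitInterval) × (Fin (m + 1) → unitInterval) =>
      cellIndex p.1 x := measurable_cellIndex.comp (measurable_fst.prodMk measurable_const)
  exact h.comp (measurable_snd.prodMk hc)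

lemma measurable_stepFun {m : ℕ} (u : Fin m → unitInterval) (w : Fin (m + 1) → unitInterval) :
    Measurable (stepFun u w) :=
  (measurable_of_countable w).comp (measurable_cellIndex.comp (measurable_const.prodMk measurable_id))

lemma measurable_likelihood_joint {m n : ℕ} (d : Fin n → unitInterval × Bool) :
    Measurable fun p : (Fin m → unitInterval) × (Fin (m + 1) → unitInterval) =>
      likelihood p.1 d p.2 := by
  simp only [likelihood_eq_prod]
  exact Finset.measurable_fun_prod _ fun k _ =>
    (continuous_bern _).measurable.comp (measurable_stepFun_joint _)

lemma measurable_likelihood {m n : ℕ} (u : Fin m → unitInterval)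
    (d : Fin n → unitInterval × Bool) : Measurable (likelihood u d) := by
  unfold likelihood
  fun_prop

lemma integrable_likelihood {m n : ℕ} (u : Fin m → unitInterval)
    (d : Fin n → unitInterval × Bool) : Integrable (likelihood u d) :=
  Integrable.of_bound (measurable_likelihood u d).aestronglyMeasurable 1 <| .of_forall fun w => by
    rw [Real.norm_of_nonneg (likelihood_nonneg _ _ _)]; exact likelihood_le_one _ _ _

lemma splitPredictive_nonneg {m n : ℕ} (u : Fin m → unitInterval)
    (d : Fin n → unitInterval × Bool) : 0 ≤ splitPredictive u d :=
  integral_nonneg fun _ => likelihood_nonneg _ _ _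

lemma splitPredictive_le {m n : ℕ} {u : Fin m → unitInterval}
    {d : Fin n → unitInterval × Bool} {B : ℝ} (hB : ∀ w, likelihood u d w ≤ B) :
    splitPredictive u d ≤ B := by
  have := integral_mono (integrable_likelihood u d) (integrable_const B) hB
  simpa [splitPredictive] using this

lemma integrable_splitPredictive {m n : ℕ} (d : Fin n → unitInterval × Bool) :
    Integrable fun u : Fin m → unitInterval => splitPredictive u d := by
  refine Integrable.of_bound (C := 1) ?_ <| .of_forall fun u => ?_
  · exact ((measurable_likelihood_joint d).stronglyMeasurable.integral_prod_right
      (ν := volume)).aestronglyMeasurable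
  · rw [Real.norm_of_nonneg (splitPredictive_nonneg _ _)]
    exact splitPredictive_le fun w => likelihood_le_one _ _ _

lemma predictive_le {m n : ℕ} {d : Fin n → unitInterval × Bool} {B : ℝ}
    (hB : ∀ (u : Fin m → unitInterval) w, likelihood u d w ≤ B) : predictive m d ≤ B := by
  have := integral_mono (integrable_splitPredictive (m := m) d) (integrable_const B)
    fun u => splitPredictive_le (hB u)
  simpa [predictive] using this

/-- A bound on the likelihood over a set of step functions bounds its posterior mass. -/
lemma posteriorMass_le {m n : ℕ} {d : Fin n → unitInterval × Bool}
    {A : Set (unitInterval → unitInterval)} {B : ℝ}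
    (hB : ∀ (u : Fin m → unitInterval) w, stepFun u w ∈ A → likelihood u d w ≤ B) :
    posteriorMass m d A ≤ ENNReal.ofReal B / ENNReal.ofReal (predictive m d) := by
  unfold posteriorMass
  gcongr
  have key : ∀ u : Fin m → unitInterval, splitPosterior u d {w | stepFun u w ∈ A} *
      ENNReal.ofReal (splitPredictive u d) ≤ ENNReal.ofReal B := by
    intro u
    rcases (splitPredictive_nonneg u d).eq_or_lt with h0 | h0
    · simp [← h0]
    have hmeas : Measurable fun w => ENNReal.ofReal (likelihood u d w / splitPredictive u d) :=
      ((measurable_likelihood u d).div_const _).ennreal_ofReal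
    have hT : MeasurableSet {w | likelihood u d w ≤ B} :=
      measurableSet_le (measurable_likelihood u d) measurable_const
    -- `A` need not be measurable, so it is enlarged to the measurable sublevel set of the
    -- likelihood.
    calc splitPosterior u d {w | stepFun u w ∈ A} * ENNReal.ofReal (splitPredictive u d)
        ≤ splitPosterior u d {w | likelihood u d w ≤ B} *
            ENNReal.ofReal (splitPredictive u d) := by
          gcongr
          exact fun hw => hB u _ hw
      _ = ∫⁻ w in {w | likelihood u d w ≤ B}, ENNReal.ofReal (likelihood u d w) := by
          rw [splitPosterior, withDensity_apply _ hT, ← lintegral_mul_const _ hmeas]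
          refine lintegral_congr fun w => ?_
          rw [← ENNReal.ofReal_mul (div_nonneg (likelihood_nonneg _ _ _) h0.le),
            div_mul_cancel₀ _ h0.ne']
      _ ≤ ∫⁻ w in {w | likelihood u d w ≤ B}, ENNReal.ofReal B :=
          setLIntegral_mono measurable_const fun w hw => ENNReal.ofReal_le_ofReal hw
      _ ≤ ENNReal.ofReal B := by
          rw [setLIntegral_const]
          exact mul_le_of_le_one_right' prob_le_one
  calc _ ≤ ∫⁻ _ : Fin m → unitInterval, ENNReal.ofReal B := lintegral_mono key
    _ = ENNReal.ofReal B := by simp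

/-! ### Means and deviation inequalities for the data -/

section DataStream

variable {Ω : Type*} [MeasurableSpace Ω] {P : Measure Ω}
  {f : unitInterval → unitInterval} {X : ℕ → Ω → unitInterval} {Y : ℕ → Ω → Bool}

/-- The mean of `h (X, Y)` when `X` is uniform and `Y` given `X` is Bernoulli with parameter
`f X`. -/
noncomputable def dataMean (f : unitInterval → unitInterval) (h : unitInterval × Bool → ℝ) : ℝ :=
  ∫ x, (bern (f x) true * h (x, true) + bern (f x) false * h (x, false))

lemma integrable_of_abs_le {α : Type*} [MeasurableSpace α] {μ : Measure α} [IsFiniteMeasure μ]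
    {h : α → ℝ} (hm : Measurable h) {B : ℝ} (hB : ∀ x, |h x| ≤ B) : Integrable h μ :=
  Integrable.of_bound hm.aestronglyMeasurable B (.of_forall hB)

lemma measurable_bern_comp (hf : Measurable f) (b : Bool) :
    Measurable fun x => bern (f x) b := (continuous_bern b).measurable.comp hf

lemma IsDataStream.measurable_pair (hD : IsDataStream P f X Y) (i : ℕ) :
    Measurable fun ω => (X i ω, Y i ω) := (hD.measurable_X i).prodMk (hD.measurable_Y i)

variable [IsProbabilityMeasure P]

/-- The factor `k (X i)` is measurable with respect to the conditioning σ-algebra, so it can be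
pulled out of the conditional expectation and the indicator replaced by `f (X i)`. -/
lemma IsDataStream.integral_indicator_mul (hD : IsDataStream P f X Y) (hf : Measurable f) (i : ℕ)
    {k : unitInterval → ℝ} (hk : Measurable k) {B : ℝ} (hB : ∀ x, |k x| ≤ B) :
    ∫ ω, k (X i ω) * {ω | Y i ω = true}.indicator (fun _ => (1 : ℝ)) ω ∂P
      = ∫ x, (f x : ℝ) * k x := by
  have hX := hD.measurable_X i
  have hY : MeasurableSet {ω | Y i ω = true} := hD.measurable_Y i (measurableSet_singleton true)
  have hle : MeasurableSpace.comap (X i) inferInstance ≤ (inferInstance : MeasurableSpace Ω) :=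
    hX.comap_le
  have hsm : StronglyMeasurable[MeasurableSpace.comap (X i) inferInstance] fun ω => k (X i ω) :=
    (hk.comp (comap_measurable (X i))).stronglyMeasurable
  have hI : Integrable ({ω | Y i ω = true}.indicator fun _ => (1 : ℝ)) P :=
    (integrable_const 1).indicator hY
  have hkI : Integrable (fun ω => k (X i ω)) P :=
    integrable_of_abs_le (hk.comp hX) fun ω => hB _
  have hprod : Integrable ((fun ω => k (X i ω)) *
      {ω | Y i ω = true}.indicator fun _ => (1 : ℝ)) P :=
    hI.bdd_mul hkI.aestronglyMeasurable (c := B) (.of_forall fun ω => hB _)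
  have h1 := condExp_mul_of_stronglyMeasurable_left hsm hprod hI
  have h2 : ∫ ω, k (X i ω) * (f (X i ω) : ℝ) ∂P = ∫ x, (f x : ℝ) * k x := by
    rw [← hD.law_X i, integral_map hX.aemeasurable]
    · simp only [mul_comm]
    · exact ((measurable_subtype_coe.comp hf).mul hk).aestronglyMeasurable
  rw [← h2]
  change ∫ ω, ((fun ω => k (X i ω)) * {ω | Y i ω = true}.indicator fun _ => (1 : ℝ)) ω ∂P = _
  rw [← integral_condExp hle]
  refine integral_congr_ae ?_
  filter_upwards [h1, hD.cond_Y i] with ω h1 h3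
  rw [h1, Pi.mul_apply, h3]

/-- A function of a Boolean is affine in the indicator of success, which reduces the joint law of
`(X, Y)` to `integral_indicator_mul`. -/
lemma IsDataStream.integral_eq_dataMean (hD : IsDataStream P f X Y) (hf : Measurable f) (i : ℕ)
    {h : unitInterval × Bool → ℝ} (hh : Measurable h) {B : ℝ} (hB : ∀ z, |h z| ≤ B) :
    ∫ ω, h (X i ω, Y i ω) ∂P = dataMean f h := by
  have hX := hD.measurable_X i
  have hY : MeasurableSet {ω | Y i ω = true} := hD.measurable_Y i (measurableSet_singleton true)
  have ht : Measurable fun x => h (x, true) := hh.comp (by fun_prop)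
  have hfl : Measurable fun x => h (x, false) := hh.comp (by fun_prop)
  have hdB : ∀ x, |h (x, true) - h (x, false)| ≤ B + B := fun x =>
    (abs_sub _ _).trans (add_le_add (hB _) (hB _))
  have hfm : Measurable fun x => (f x : ℝ) := measurable_subtype_coe.comp hf
  have hI2 : Integrable (fun x => (f x : ℝ) * (h (x, true) - h (x, false))) :=
    integrable_of_abs_le (hfm.mul (ht.sub hfl)) (B := B + B) fun x => by
      rw [abs_mul, abs_of_nonneg (f x).2.1]
      exact (mul_le_of_le_one_left (abs_nonneg _) (f x).2.2).trans (hdB x)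
  calc ∫ ω, h (X i ω, Y i ω) ∂P
      = ∫ ω, (h (X i ω, false) + (h (X i ω, true) - h (X i ω, false)) *
          {ω | Y i ω = true}.indicator (fun _ => (1 : ℝ)) ω) ∂P := by
        refine integral_congr_ae (.of_forall fun ω => ?_)
        by_cases hω : Y i ω = true
        · simp [hω]
        · simp [hω]
    _ = (∫ x, h (x, false)) + ∫ x, (f x : ℝ) * (h (x, true) - h (x, false)) := by
        rw [integral_add,
          hD.integral_indicator_mul hf i (k := fun x => h (x, true) - h (x, false))
            (ht.sub hfl) hdB]
        · rw [← hD.law_X i, integral_map hX.aemeasurable hfl.aestronglyMeasurable]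
        · exact integrable_of_abs_le (hfl.comp hX) fun ω => hB _
        · exact ((integrable_const (1 : ℝ)).indicator hY).bdd_mul
            ((ht.sub hfl).comp hX).aestronglyMeasurable (c := B + B) (.of_forall fun ω => hdB _)
    _ = dataMean f h := by
        rw [← integral_add (integrable_of_abs_le hfl fun x => hB _) hI2, dataMean]
        refine integral_congr_ae (.of_forall fun x => ?_)
        simp only [bern_true, bern_false]
        ring

/-- Chebyshev's inequality for the empirical mean of a bounded function of the data. -/
lemma IsDataStream.prob_deviation_le (hD : IsDataStream P f X Y) (hf : Measurable f)
    {h : unitInterval × Bool → ℝ} (hh : Measurable h) {B : ℝ} (hB : ∀ z, |h z| ≤ B)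
    {η : ℝ} (hη : 0 < η) {n : ℕ} (hn : 0 < n) :
    P {ω | n * η ≤ |∑ k, h (sample X Y n ω k) - n * dataMean f h|}
      ≤ ENNReal.ofReal (B ^ 2 / (n * η ^ 2)) := by
  have hn' : (0 : ℝ) < n := Nat.cast_pos.2 hn
  have hm : ∀ i : Fin n, Measurable fun ω => h (X i ω, Y i ω) :=
    fun i => hh.comp (hD.measurable_pair i)
  have hL : ∀ i : Fin n, MemLp (fun ω => h (X i ω, Y i ω)) 2 P := fun i =>
    MemLp.of_bound (hm i).aestronglyMeasurable B (.of_forall fun ω => hB _)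
  have hmean : ∫ ω, (∑ i : Fin n, fun ω => h (X i ω, Y i ω)) ω ∂P = n * dataMean f h := by
    simp only [Finset.sum_apply]
    rw [integral_finsetSum _ fun i _ => (hL i).integrable (by norm_num)]
    simp [hD.integral_eq_dataMean hf _ hh hB]
  have hvar : variance (∑ i : Fin n, fun ω => h (X i ω, Y i ω)) P ≤ n * B ^ 2 := by
    rw [IndepFun.variance_sum (fun i _ => hL i)]
    · calc _ ≤ ∑ i : Fin n, B ^ 2 := by
            refine Finset.sum_le_sum fun i _ => ?_
            have := variance_le_sq_of_bounded (μ := P) (X := fun ω => h (X i ω, Y i ω))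
              (a := -B) (b := B) (.of_forall fun ω => abs_le.1 (hB _)) (hm i).aemeasurable
            calc _ ≤ _ := this
              _ = B ^ 2 := by ring
        _ = _ := by simp
    · intro i _ j _ hij
      exact (hD.indep.indepFun (i := i) (j := j) (by simpa [Fin.ext_iff] using hij)).comp hh hh
  have := meas_ge_le_variance_div_sq (memLp_finsetSum' Finset.univ fun i _ => hL i)
    (mul_pos hn' hη)
  rw [hmean] at this
  simp only [Finset.sum_apply] at this
  refine this.trans (ENNReal.ofReal_le_ofReal ?_)
  calc _ ≤ n * B ^ 2 / (n * η) ^ 2 := by gcongr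
    _ = _ := by field_simp

/-- The exponential Markov inequality for products of a bounded function of the data. -/
lemma IsDataStream.prob_prod_ge_le (hD : IsDataStream P f X Y) (hf : Measurable f)
    {h : unitInterval × Bool → ℝ} (hh : Measurable h) (h0 : ∀ z, 0 ≤ h z) {B : ℝ}
    (hB : ∀ z, h z ≤ B) {r η : ℝ} (hr : 0 < r) (hmean : dataMean f h ≤ r) (n : ℕ) :
    P {ω | (r * Real.exp η) ^ n ≤ ∏ k, h (sample X Y n ω k)}
      ≤ ENNReal.ofReal (Real.exp (-(n * η))) := by
  have hB' : ∀ z, |h z| ≤ B := fun z => by rw [abs_of_nonneg (h0 z)]; exact hB z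
  have hm : ∀ i : Fin n, Measurable fun ω => h (X i ω, Y i ω) :=
    fun i => hh.comp (hD.measurable_pair i)
  have hind : iIndepFun (fun (i : Fin n) ω => h (X i ω, Y i ω)) P :=
    (hD.indep.precomp Fin.val_injective).comp (fun _ => h) fun _ => hh
  have hE : ∫ ω, ∏ k, h (sample X Y n ω k) ∂P = dataMean f h ^ n := by
    simp only [sample]
    rw [hind.integral_fun_prod_eq_prod_integral fun i => (hm i).aestronglyMeasurable]
    simp [hD.integral_eq_dataMean hf _ hh hB']
  have hmn : 0 ≤ dataMean f h := integral_nonneg fun x =>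
    add_nonneg (mul_nonneg (bern_nonneg _ _) (h0 _)) (mul_nonneg (bern_nonneg _ _) (h0 _))
  have hint : Integrable (fun ω => ∏ k, h (sample X Y n ω k)) P := by
    refine integrable_of_abs_le (B := B ^ n) (Finset.measurable_fun_prod _ fun i _ => hm i) ?_
    intro ω
    rw [Finset.abs_prod]
    calc _ ≤ ∏ k : Fin n, B := Finset.prod_le_prod (fun _ _ => abs_nonneg _) fun _ _ => hB' _
      _ = _ := by simp
  have hmarkov := mul_meas_ge_le_integral_of_nonneg
    (.of_forall fun ω => Finset.prod_nonneg fun k _ => h0 (sample X Y n ω k)) hint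
    ((r * Real.exp η) ^ n)
  rw [hE] at hmarkov
  rw [← ofReal_measureReal]
  refine ENNReal.ofReal_le_ofReal ?_
  have hpos : 0 < (r * Real.exp η) ^ n := by positivity
  calc _ ≤ dataMean f h ^ n / (r * Real.exp η) ^ n := by
        rw [le_div_iff₀ hpos, mul_comm]; exact hmarkov
    _ ≤ r ^ n / (r * Real.exp η) ^ n := by gcongr
    _ = Real.exp (-(n * η)) := by
        rw [mul_pow, ← Real.exp_nat_mul, Real.exp_neg]
        field_simp

end DataStream

/-! ### Grid brackets for step functions -/

/-- The index of the cell of the regular grid with mesh `1 / M` that contains `x`. -/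
noncomputable def gridCell (M : ℕ) (x : unitInterval) : Fin (M + 1) :=
  ⟨⌊(x : ℝ) * M⌋₊, Nat.lt_succ_of_le <| Nat.floor_le_of_le <|
    mul_le_of_le_one_left (Nat.cast_nonneg M) x.2.2⟩

lemma gridCell_monotone (M : ℕ) : Monotone (gridCell M) := fun x y h => by
  have : (x : ℝ) ≤ y := h
  exact Fin.mk_le_mk.2 (Nat.floor_mono (by gcongr))

lemma measurable_gridCell (M : ℕ) : Measurable (gridCell M) := by
  have h : Measurable fun x : unitInterval => (gridCell M x : ℕ) :=
    Nat.measurable_floor.comp (measurable_subtype_coe.mul_const _)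
  refine measurable_to_countable' fun i => ?_
  convert h (measurableSet_singleton (i : ℕ)) using 1
  ext p
  simp [Fin.ext_iff]

lemma volume_gridCell_le {M : ℕ} (hM : 0 < M) (j : Fin (M + 1)) :
    volume {x | gridCell M x = j} ≤ ENNReal.ofReal (1 / M) := by
  have hM' : (0 : ℝ) < M := Nat.cast_pos.2 hM
  rw [unitInterval.volume_apply]
  calc _ ≤ volume (Set.Ico ((j : ℕ) / M : ℝ) (((j : ℕ) + 1) / M)) := by
        refine measure_mono ?_
        rintro _ ⟨x, hx, rfl⟩
        have hx' : ⌊(x : ℝ) * M⌋₊ = j := congrArg Fin.val hx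
        rw [Nat.floor_eq_iff (mul_nonneg x.2.1 hM'.le)] at hx'
        exact ⟨(div_le_iff₀ hM').2 hx'.1, (lt_div_iff₀ hM').2 hx'.2⟩
    _ = _ := by
        rw [Real.volume_Ico]
        congr 1
        ring

/-- The union of the grid cells that contain a split point. -/
def splitCells (M : ℕ) {m : ℕ} (u : Fin m → unitInterval) : Set unitInterval :=
  {x | ∃ i, gridCell M x = gridCell M (u i)}

lemma measurableSet_splitCells (M : ℕ) {m : ℕ} (u : Fin m → unitInterval) :
    MeasurableSet (splitCells M u) := by
  have : splitCells M u = ⋃ i, gridCell M ⁻¹' {gridCell M (u i)} := by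
    ext x; simp [splitCells]
  rw [this]
  exact MeasurableSet.iUnion fun i => measurable_gridCell M (measurableSet_singleton _)

lemma volume_splitCells_le {M : ℕ} (hM : 0 < M) {m : ℕ} (u : Fin m → unitInterval) :
    volume.real (splitCells M u) ≤ m / M := by
  have : splitCells M u = ⋃ i, {x | gridCell M x = gridCell M (u i)} := by
    ext x; simp [splitCells]
  refine ENNReal.toReal_le_of_le_ofReal (by positivity) ?_
  rw [this]
  calc _ ≤ ∑ i : Fin m, volume {x | gridCell M x = gridCell M (u i)} :=
        measure_iUnion_fintype_le _ _
    _ ≤ ∑ i : Fin m, ENNReal.ofReal (1 / M) :=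
        Finset.sum_le_sum fun i _ => volume_gridCell_le hM _
    _ = ENNReal.ofReal (m / M) := by
        rw [Finset.sum_const, Finset.card_univ, Fintype.card_fin, nsmul_eq_mul,
          ← ENNReal.ofReal_natCast, ← ENNReal.ofReal_mul (Nat.cast_nonneg m)]
        congr 1
        ring

/-- A split point separating `x` from `y` would, by monotonicity of `gridCell`, lie in their common
grid cell. -/
lemma cellIndex_eq_of_gridCell_eq {M m : ℕ} {u : Fin m → unitInterval} {x y : unitInterval}
    (hxy : gridCell M x = gridCell M y) (hu : ∀ i, gridCell M (u i) ≠ gridCell M x) :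
    cellIndex u x = cellIndex u y := by
  have key : ∀ {x y : unitInterval}, gridCell M x = gridCell M y →
      (∀ i, gridCell M (u i) ≠ gridCell M x) → ∀ i, u i < x → u i < y := by
    intro x y hxy hu i hi
    by_contra! h
    exact hu i (le_antisymm (gridCell_monotone M hi.le) (hxy ▸ gridCell_monotone M h))
  refine Fin.ext ?_
  simp only [cellIndex]
  refine congrArg Finset.card (Finset.filter_congr fun i _ => ?_)
  exact ⟨key hxy hu i, key hxy.symm (hxy ▸ hu) i⟩

/-- The function on `[0,1] × {0,1}` that is constant on grid cells, with values `σ / r`. -/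
noncomputable def gridFun {M r : ℕ} (σ : Fin (M + 1) × Bool → Fin (r + 1))
    (z : unitInterval × Bool) : ℝ := (σ (gridCell M z.1, z.2) : ℕ) / r

lemma measurable_gridFun {M r : ℕ} (σ : Fin (M + 1) × Bool → Fin (r + 1)) :
    Measurable (gridFun σ) :=
  measurable_of_bool_slices fun b =>
    (measurable_of_countable fun j => ((σ (j, b) : ℕ) : ℝ) / r).comp (measurable_gridCell M)

lemma gridFun_nonneg {M r : ℕ} (σ : Fin (M + 1) × Bool → Fin (r + 1))
    (z : unitInterval × Bool) : 0 ≤ gridFun σ z := by unfold gridFun; positivity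

lemma gridFun_le_one {M r : ℕ} (σ : Fin (M + 1) × Bool → Fin (r + 1))
    (z : unitInterval × Bool) : gridFun σ z ≤ 1 :=
  div_le_one_of_le₀ (Nat.cast_le.2 (Nat.le_of_lt_succ (σ _).2)) (Nat.cast_nonneg r)

/-- The square root of the likelihood function of a step function is bounded above by a grid
function that is close to it outside the grid cells that contain a split point. -/
lemma exists_gridFun_bracket {M r m : ℕ} (hr : 0 < r) (u : Fin m → unitInterval)
    (w : Fin (m + 1) → unitInterval) :
    ∃ σ : Fin (M + 1) × Bool → Fin (r + 1),
      (∀ z, √(bern (stepFun u w z.1) z.2) ≤ gridFun σ z) ∧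
      ∀ z, gridFun σ z ≤ √(bern (stepFun u w z.1) z.2) + 1 / r +
        (splitCells M u).indicator (fun _ => 1) z.1 := by
  classical
  have hr' : (0 : ℝ) < r := Nat.cast_pos.2 hr
  have hs1 : ∀ p b, √(bern p b) ≤ 1 := fun p b => Real.sqrt_le_one.2 (bern_le_one p b)
  let c : Fin (M + 1) → unitInterval := Function.invFun (gridCell M)
  have hc : ∀ x, gridCell M (c (gridCell M x)) = gridCell M x := fun x =>
    Function.invFun_eq ⟨x, rfl⟩
  -- The trivial bound `1` on cells with a split point; elsewhere the constant value rounded up to a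
  -- multiple of `1 / r`.
  let σ : Fin (M + 1) × Bool → Fin (r + 1) := fun j =>
    if ∃ i, j.1 = gridCell M (u i) then Fin.last r else
      ⟨⌈√(bern (stepFun u w (c j.1)) j.2) * r⌉₊, Nat.lt_succ_of_le <| Nat.ceil_le.2 <|
        mul_le_of_le_one_left hr'.le (hs1 _ _)⟩
  have hbad : ∀ z : unitInterval × Bool, z.1 ∈ splitCells M u → gridFun σ z = 1 := by
    intro z hz
    have hz' : ∃ i, gridCell M z.1 = gridCell M (u i) := hz
    simp [gridFun, σ, hz', hr'.ne']
  have hgood : ∀ z : unitInterval × Bool, z.1 ∉ splitCells M u →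
      gridFun σ z = (⌈√(bern (stepFun u w z.1) z.2) * r⌉₊ : ℝ) / r := by
    intro z hz
    have hz' : ¬ ∃ i, gridCell M z.1 = gridCell M (u i) := hz
    have hst : stepFun u w (c (gridCell M z.1)) = stepFun u w z.1 := by
      unfold stepFun
      rw [cellIndex_eq_of_gridCell_eq (hc z.1)]
      intro i hi
      exact hz' ⟨i, by rw [hi, hc]⟩
    simp only [gridFun, σ, if_neg hz', hst]
  refine ⟨σ, fun z => ?_, fun z => ?_⟩
  · by_cases hz : z.1 ∈ splitCells M u
    · rw [hbad z hz]; exact hs1 _ _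
    · rw [hgood z hz, le_div_iff₀ hr']; exact Nat.le_ceil _
  · by_cases hz : z.1 ∈ splitCells M u
    · rw [hbad z hz, Set.indicator_of_mem hz]
      have := Real.sqrt_nonneg (bern (stepFun u w z.1) z.2)
      have : (0 : ℝ) ≤ 1 / r := by positivity
      linarith
    · rw [hgood z hz, Set.indicator_of_notMem hz, add_zero, div_le_iff₀ hr', add_mul,
        one_div, inv_mul_cancel₀ hr'.ne']
      exact (Nat.ceil_lt_add_one (by positivity)).le

/-! ### Hellinger affinity and the truncated likelihood -/

lemma sq_sub_le_four_mul_sq_sqrt_sub {a b : ℝ} (ha : 0 ≤ a) (ha1 : a ≤ 1) (hb : 0 ≤ b)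
    (hb1 : b ≤ 1) : (a - b) ^ 2 ≤ 4 * (√a - √b) ^ 2 := by
  have h1 : a - b = (√a - √b) * (√a + √b) := by
    nlinarith [Real.sq_sqrt ha, Real.sq_sqrt hb]
  have h2 : √a + √b ≤ 2 := by
    linarith [Real.sqrt_le_one.2 ha1, Real.sqrt_le_one.2 hb1]
  have h3 : (√a + √b) ^ 2 ≤ 4 := by nlinarith [Real.sqrt_nonneg a, Real.sqrt_nonneg b]
  rw [h1, mul_pow]
  nlinarith [sq_nonneg (√a - √b)]

/-- The Hellinger affinity of two Bernoulli distributions. -/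
lemma hellinger_affinity_le (p q : unitInterval) :
    √(bern p true) * √(bern q true) + √(bern p false) * √(bern q false)
      ≤ 1 - ((p : ℝ) - q) ^ 2 / 4 := by
  have h1 := sq_sub_le_four_mul_sq_sqrt_sub (bern_nonneg p true) (bern_le_one p true)
    (bern_nonneg q true) (bern_le_one q true)
  have h2 := sq_sub_le_four_mul_sq_sqrt_sub (bern_nonneg p false) (bern_le_one p false)
    (bern_nonneg q false) (bern_le_one q false)
  have e1 := Real.sq_sqrt (bern_nonneg p true)
  have e2 := Real.sq_sqrt (bern_nonneg q true)
  have e3 := Real.sq_sqrt (bern_nonneg p false)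
  have e4 := Real.sq_sqrt (bern_nonneg q false)
  simp only [bern_true, bern_false] at *
  -- One minus the affinity is half the sum of the two squared differences of square roots, each at
  -- least `(p - q) ^ 2 / 4`.
  nlinarith

/-- The likelihood function of `f`, truncated from below at `t`. -/
noncomputable def truncLik (f : unitInterval → unitInterval) (t : ℝ)
    (z : unitInterval × Bool) : ℝ := max (bern (f z.1) z.2) t

section

variable {f : unitInterval → unitInterval} {t : ℝ}

lemma measurable_truncLik (hf : Measurable f) : Measurable (truncLik f t) :=
  measurable_of_bool_slices fun b => (measurable_bern_comp hf b).max measurable_const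

lemma truncLik_pos (ht : 0 < t) (z : unitInterval × Bool) : 0 < truncLik f t z :=
  lt_max_of_lt_right ht

/-- This is what truncation is for: `f` may take the values `0` and `1`, yet Chebyshev's inequality
needs a bounded log-likelihood. -/
lemma abs_log_truncLik_le (ht : 0 < t) (ht1 : t ≤ 1) (z : unitInterval × Bool) :
    |Real.log (truncLik f t z)| ≤ -Real.log t := by
  have h1 : Real.log t ≤ Real.log (truncLik f t z) := Real.log_le_log ht (le_max_right _ _)
  have h2 : Real.log (truncLik f t z) ≤ 0 :=
    Real.log_nonpos (truncLik_pos ht z).le (max_le (bern_le_one _ _) ht1)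
  rw [abs_of_nonpos h2]
  linarith

/-- The price of truncation: `p * log (max p t / p) ≤ max p t - p ≤ t` by `log x ≤ x - 1`. -/
lemma mul_log_max_le {p : ℝ} (hp : 0 ≤ p) (ht : 0 < t) :
    p * Real.log (max p t) ≤ -Real.negMulLog p + t := by
  rcases hp.eq_or_lt with rfl | hp
  · simp [ht.le]
  have hm : 0 < max p t := lt_max_of_lt_left hp
  have h1 : Real.log (max p t / p) ≤ max p t / p - 1 := Real.log_le_sub_one_of_pos (by positivity)
  rw [Real.log_div hm.ne' hp.ne'] at h1
  have h2 : p * (Real.log (max p t) - Real.log p) ≤ p * (max p t / p - 1) := by gcongr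
  have h3 : p * (max p t / p - 1) = max p t - p := by field_simp
  have h4 : max p t ≤ p + t := max_le (by linarith) (by linarith)
  rw [Real.negMulLog]
  linarith

lemma integrable_binEntropy (hf : Measurable f) :
    Integrable fun x => Real.binEntropy (f x : ℝ) :=
  integrable_of_abs_le (B := Real.log 2)
    (Real.binEntropy_continuous.measurable.comp (measurable_subtype_coe.comp hf)) fun x => by
      rw [abs_of_nonneg (Real.binEntropy_nonneg (f x).2.1 (f x).2.2)]
      exact Real.binEntropy_le_log_two

lemma abs_bern_mul_add_le (p : unitInterval) {a b B : ℝ} (ha : |a| ≤ B) (hb : |b| ≤ B) :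
    |bern p true * a + bern p false * b| ≤ B := by
  have := abs_le.1 ha
  have := abs_le.1 hb
  have := p.2.1
  have := p.2.2
  rw [bern_true, bern_false, abs_le]
  constructor <;> nlinarith

lemma integrable_dataMean (hf : Measurable f) {h : unitInterval × Bool → ℝ} (hh : Measurable h)
    {B : ℝ} (hB : ∀ z, |h z| ≤ B) :
    Integrable fun x => bern (f x) true * h (x, true) + bern (f x) false * h (x, false) := by
  refine integrable_of_abs_le (B := B) ?_ fun x => abs_bern_mul_add_le _ (hB _) (hB _)
  exact ((measurable_bern_comp hf _).mul (hh.comp (by fun_prop))).add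
    ((measurable_bern_comp hf _).mul (hh.comp (by fun_prop)))

lemma dataMean_log_truncLik_le (hf : Measurable f) (ht : 0 < t) (ht1 : t ≤ 1) :
    dataMean f (fun z => Real.log (truncLik f t z)) ≤ -entropy f + 2 * t := by
  have hI := integrable_binEntropy hf
  calc _ ≤ ∫ x, (-Real.binEntropy (f x : ℝ) + 2 * t) := by
        refine integral_mono (integrable_dataMean hf (measurable_truncLik hf).log
          (abs_log_truncLik_le ht ht1)) (hI.neg.add (integrable_const _)) fun x => ?_
        have h1 := mul_log_max_le (bern_nonneg (f x) true) ht
        have h2 := mul_log_max_le (bern_nonneg (f x) false) ht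
        simp only [truncLik] at *
        rw [Real.binEntropy_eq_negMulLog_add_negMulLog_one_sub]
        simp only [bern_true, bern_false] at *
        linarith
    _ = _ := by
        rw [integral_add (f := fun x => -Real.binEntropy (f x : ℝ)) hI.neg (integrable_const _),
          integral_neg]
        simp [entropy]

/-- Truncation only raises the denominator, so the mean of `V / √q` is still dominated by an
affinity integral of `√p * V`. -/
lemma div_sqrt_truncLik_le (ht : 0 < t) {V : ℝ} (hV : 0 ≤ V) (z : unitInterval × Bool) :
    bern (f z.1) z.2 * (V / √(truncLik f t z)) ≤ √(bern (f z.1) z.2) * V := by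
  have hq := Real.sqrt_pos.2 (truncLik_pos (f := f) ht z)
  have h1 : √(bern (f z.1) z.2) ≤ √(truncLik f t z) := Real.sqrt_le_sqrt (le_max_left _ _)
  have h2 := Real.mul_self_sqrt (bern_nonneg (f z.1) z.2)
  rw [← mul_div_assoc, div_le_iff₀ hq]
  nlinarith [mul_le_mul_of_nonneg_left h1 (mul_nonneg (Real.sqrt_nonneg (bern (f z.1) z.2)) hV)]

lemma gridFun_div_sqrt_truncLik_le {M r : ℕ} (σ : Fin (M + 1) × Bool → Fin (r + 1)) (ht : 0 < t)
    (z : unitInterval × Bool) : gridFun σ z / √(truncLik f t z) ≤ 1 / √t :=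
  div_le_div₀ zero_le_one (gridFun_le_one _ _) (Real.sqrt_pos.2 ht)
    (Real.sqrt_le_sqrt (le_max_right _ _))

lemma measurable_gridFun_div (hf : Measurable f) {M r : ℕ}
    (σ : Fin (M + 1) × Bool → Fin (r + 1)) :
    Measurable fun z => gridFun σ z / √(truncLik f t z) :=
  (measurable_gridFun σ).div (measurable_truncLik hf).sqrt

/-- The Hellinger transform of a bracket decreases with the `L¹` distance of the bracketed step
function from `f`. -/
lemma dataMean_gridFun_le (hf : Measurable f) (ht : 0 < t) {M r m : ℕ} (hM : 0 < M)
    (u : Fin m → unitInterval) (w : Fin (m + 1) → unitInterval)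
    {σ : Fin (M + 1) × Bool → Fin (r + 1)}
    (hσ : ∀ z, gridFun σ z ≤ √(bern (stepFun u w z.1) z.2) + 1 / r +
        (splitCells M u).indicator (fun _ => 1) z.1) :
    dataMean f (fun z => gridFun σ z / √(truncLik f t z))
      ≤ 1 - l1Dist (stepFun u w) f ^ 2 / 4 + 2 / r + 2 * (m / M) := by
  set g := stepFun u w
  set D := l1Dist g f with hD
  have hgm : Measurable g := measurable_stepFun u w
  have hI : Integrable fun x => |(g x : ℝ) - f x| :=
    integrable_of_abs_le (B := 1)
      ((measurable_subtype_coe.comp hgm).sub (measurable_subtype_coe.comp hf)).abs fun x => by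
        rw [abs_abs, abs_le]
        constructor <;> linarith [(g x).2.1, (g x).2.2, (f x).2.1, (f x).2.2]
  have hS : Integrable ((splitCells M u).indicator fun _ => (1 : ℝ)) :=
    (integrable_const 1).indicator (measurableSet_splitCells M u)
  have hpt : ∀ x, bern (f x) true * (gridFun σ (x, true) / √(truncLik f t (x, true))) +
      bern (f x) false * (gridFun σ (x, false) / √(truncLik f t (x, false))) ≤
      (1 + D ^ 2 / 4 + 2 / r) - D / 2 * |(g x : ℝ) - f x| +
        2 * (splitCells M u).indicator (fun _ => 1) x := by
    intro x
    have a1 := div_sqrt_truncLik_le (f := f) ht (gridFun_nonneg σ (x, true)) (x, true)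
    have a2 := div_sqrt_truncLik_le (f := f) ht (gridFun_nonneg σ (x, false)) (x, false)
    have hh := hellinger_affinity_le (f x) (g x)
    set e : ℝ := 1 / r + (splitCells M u).indicator (fun _ => 1) x with he
    have he0 : 0 ≤ e := add_nonneg (by positivity) (Set.indicator_nonneg (by simp) _)
    have hb : ∀ b, √(bern (f x) b) * gridFun σ (x, b)
        ≤ √(bern (f x) b) * √(bern (g x) b) + e := by
      intro b
      have h1 : gridFun σ (x, b) ≤ √(bern (g x) b) + e := by
        have := hσ (x, b); rw [he]; linarith
      have h2 := mul_le_mul_of_nonneg_left h1 (Real.sqrt_nonneg (bern (f x) b))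
      have h3 : √(bern (f x) b) * e ≤ e :=
        mul_le_of_le_one_left he0 (Real.sqrt_le_one.2 (bern_le_one _ _))
      linarith
    -- The tangent line of the square at `D`, in place of Cauchy–Schwarz: since `D` is the mean of
    -- `|g - f|`, the left side integrates to `D ^ 2 / 4`.
    have hsq : D / 2 * |(g x : ℝ) - f x| - D ^ 2 / 4 ≤ ((f x : ℝ) - g x) ^ 2 / 4 := by
      have : ((f x : ℝ) - g x) ^ 2 = |(g x : ℝ) - f x| ^ 2 := by rw [sq_abs]; ring
      rw [this]
      nlinarith [sq_nonneg (|(g x : ℝ) - f x| - D)]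
    have b1 := hb true
    have b2 := hb false
    have : (2 : ℝ) / r = 2 * (1 / r) := by ring
    simp only at a1 a2
    linarith
  calc _ ≤ ∫ x, ((1 + D ^ 2 / 4 + 2 / r) - D / 2 * |(g x : ℝ) - f x| +
        2 * (splitCells M u).indicator (fun _ => 1) x) := by
        refine integral_mono (integrable_dataMean hf (measurable_gridFun_div hf σ)
          (B := 1 / √t) fun z => ?_) ?_ hpt
        · rw [abs_of_nonneg (div_nonneg (gridFun_nonneg _ _) (Real.sqrt_nonneg _))]
          exact gridFun_div_sqrt_truncLik_le σ ht z
        · exact ((integrable_const _).sub (hI.const_mul _)).add (hS.const_mul 2)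
    _ = (1 + D ^ 2 / 4 + 2 / r) - D / 2 * D + 2 * volume.real (splitCells M u) := by
        rw [integral_add
            (f := fun x => (1 + D ^ 2 / 4 + 2 / r) - D / 2 * |(g x : ℝ) - f x|)
            ((integrable_const _).sub (hI.const_mul _)) (hS.const_mul 2),
          integral_sub (integrable_const _) (hI.const_mul _), integral_const_mul,
          integral_const_mul, integral_indicator_const _ (measurableSet_splitCells M u)]
        simp [hD, l1Dist]
    _ ≤ _ := by
        have := volume_splitCells_le hM u
        nlinarith

/-! ### Uniform upper bound on the likelihood -/

/-- With high probability the likelihood of every step function with at most `ε n` split points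
is exponentially smaller than that of `f`, at a rate given by the distance to `f`. -/
theorem exists_likelihood_bound (hf : Measurable f) {s : ℝ} (hs : 0 < s) :
    ∃ ε : ℝ, 0 < ε ∧ ∃ n₀ : ℕ, ∀ n : ℕ, n₀ ≤ n → ∀ m : ℕ, 1 ≤ m → (m : ℝ) ≤ ε * n →
      ∀ {Ω : Type*} [MeasurableSpace Ω] (P : Measure Ω) [IsProbabilityMeasure P]
        (X : ℕ → Ω → unitInterval) (Y : ℕ → Ω → Bool), IsDataStream P f X Y →
        P {ω | ∀ (u : Fin m → unitInterval) w, likelihood u (sample X Y n ω) w ≤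
          Real.exp (n * (-entropy f + s - l1Dist (stepFun u w) f ^ 2 / 2))}ᶜ
          ≤ ENNReal.ofReal s := by
  obtain ⟨r, hr⟩ := exists_nat_gt (2 / (s / 16))
  have hr0' : (0 : ℝ) < r := lt_trans (by positivity) hr
  have hr0 : 0 < r := Nat.cast_pos.1 hr0'
  have hra : 2 / (r : ℝ) ≤ s / 16 := by
    rw [div_lt_iff₀ (by positivity)] at hr
    rw [div_le_iff₀ hr0']
    linarith
  -- The truncation cost `2 * t` is then at most `s / 4`; the deviation allowed in `G` costs another
  -- `s / 4`.
  set t := min (s / 8) 1 with ht_def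
  have ht : 0 < t := lt_min (by positivity) one_pos
  have ht1 : t ≤ 1 := min_le_right _ _
  have hts : t ≤ s / 8 := min_le_left _ _
  set ℓ := Real.log (r + 1) with hℓ_def
  have hℓ : 0 < ℓ := Real.log_pos (by linarith)
  obtain ⟨n₁, hn₁⟩ := exists_nat_gt (-Real.log (s / 2) / (s / 32))
  obtain ⟨n₂, hn₂⟩ := exists_nat_gt ((-Real.log t) ^ 2 / ((s / 2) * (s / 4) ^ 2))
  -- With this `ε` the log-number of brackets, at most `4 * r * m * ℓ`, is at most `n * s / 32`,
  -- half of the Markov exponent `n * s / 16`.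
  refine ⟨s / (128 * r * ℓ), by positivity, max 1 (max n₁ n₂), fun n hn m hm hmn Ω _ P _ X Y hD => ?_⟩
  have hn0 : 0 < n := lt_of_lt_of_le one_pos ((le_max_left _ _).trans hn)
  have hn0' : (0 : ℝ) < n := Nat.cast_pos.2 hn0
  have hn1 : (n₁ : ℝ) ≤ n := Nat.cast_le.2 ((le_max_left _ _).trans ((le_max_right _ _).trans hn))
  have hn2 : (n₂ : ℝ) ≤ n := Nat.cast_le.2 ((le_max_right _ _).trans ((le_max_right _ _).trans hn))
  have hm' : (1 : ℝ) ≤ m := Nat.one_le_cast.2 hm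
  -- The mesh scales with `m`, so that the cells with split points have total length at most `1 /
  -- r`.
  set M := r * m with hM_def
  have hM : 0 < M := Nat.mul_pos hr0 hm
  let ρ : (Fin (M + 1) × Bool → Fin (r + 1)) → ℝ := fun σ =>
    dataMean f (fun z => gridFun σ z / √(truncLik f t z))
  have hρ0 : ∀ σ, 0 ≤ ρ σ := fun σ => integral_nonneg fun x =>
    add_nonneg (mul_nonneg (bern_nonneg _ _) (div_nonneg (gridFun_nonneg _ _) (Real.sqrt_nonneg _)))
      (mul_nonneg (bern_nonneg _ _) (div_nonneg (gridFun_nonneg _ _) (Real.sqrt_nonneg _)))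
  -- The thresholds involve only the bracket, never `u` or `w`, so one finite union serves all step
  -- functions. The added `s / 16` keeps the base positive even if `ρ σ = 0`.
  let F : (Fin (M + 1) × Bool → Fin (r + 1)) → Set Ω := fun σ =>
    {ω | ((ρ σ + s / 16) * Real.exp (s / 16)) ^ n ≤
      ∏ k, gridFun σ (sample X Y n ω k) / √(truncLik f t (sample X Y n ω k))}
  let G : Set Ω := {ω | n * (s / 4) ≤ |∑ k, Real.log (truncLik f t (sample X Y n ω k)) -
    n * dataMean f (fun z => Real.log (truncLik f t z))|}
  have hF : P (⋃ σ, F σ) ≤ ENNReal.ofReal (s / 2) := by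
    calc P (⋃ σ, F σ) ≤ ∑ σ, P (F σ) := measure_iUnion_fintype_le _ _
      _ ≤ ∑ σ : Fin (M + 1) × Bool → Fin (r + 1), ENNReal.ofReal (Real.exp (-(n * (s / 16)))) := by
          refine Finset.sum_le_sum fun σ _ => ?_
          exact hD.prob_prod_ge_le hf (measurable_gridFun_div hf σ)
            (fun z => div_nonneg (gridFun_nonneg _ _) (Real.sqrt_nonneg _))
            (gridFun_div_sqrt_truncLik_le σ ht) (add_pos_of_nonneg_of_pos (hρ0 σ) (by positivity))
            (by linarith : ρ σ ≤ ρ σ + s / 16) n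
      _ = ENNReal.ofReal (((r + 1 : ℝ) ^ ((M + 1) * 2)) * Real.exp (-(n * (s / 16)))) := by
          rw [Finset.sum_const, Finset.card_univ, nsmul_eq_mul, ← ENNReal.ofReal_natCast,
            ← ENNReal.ofReal_mul (Nat.cast_nonneg _)]
          simp
      _ ≤ ENNReal.ofReal (s / 2) := by
          refine ENNReal.ofReal_le_ofReal ?_
          have h1 : ((r + 1 : ℝ) ^ ((M + 1) * 2)) = Real.exp (((M + 1) * 2 : ℕ) * ℓ) := by
            rw [Real.exp_nat_mul, hℓ_def, Real.exp_log (by positivity)]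
          rw [h1, ← Real.exp_add, ← Real.le_log_iff_exp_le (by positivity)]
          have h2 : (((M + 1) * 2 : ℕ) : ℝ) ≤ 4 * (r * m) := by
            rw [hM_def]; push_cast
            have : (1 : ℝ) ≤ r * m := by exact_mod_cast hM
            linarith
          have h3 : (((M + 1) * 2 : ℕ) : ℝ) * ℓ ≤ 4 * (r * m) * ℓ := by gcongr
          have h4 : 4 * (r * m) * ℓ ≤ n * (s / 32) := by
            calc 4 * (r * m) * ℓ ≤ 4 * (r * (s / (128 * r * ℓ) * n)) * ℓ := by gcongr
              _ = n * (s / 32) := by field_simp; norm_num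
          have h5 : -Real.log (s / 2) < n * (s / 32) := by
            rw [div_lt_iff₀ (by positivity)] at hn₁
            nlinarith
          linarith
  have hG : P G ≤ ENNReal.ofReal (s / 2) := by
    refine (hD.prob_deviation_le hf (measurable_truncLik hf).log (abs_log_truncLik_le ht ht1)
      (by positivity : 0 < s / 4) hn0).trans (ENNReal.ofReal_le_ofReal ?_)
    rw [div_lt_iff₀ (by positivity)] at hn₂
    rw [div_le_iff₀ (by positivity)]
    have : (n₂ : ℝ) * (s / 2 * (s / 4) ^ 2) ≤ n * (s / 2 * (s / 4) ^ 2) := by gcongr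
    linarith
  have hsub : {ω | ∀ (u : Fin m → unitInterval) w, likelihood u (sample X Y n ω) w ≤
      Real.exp (n * (-entropy f + s - l1Dist (stepFun u w) f ^ 2 / 2))}ᶜ ⊆ (⋃ σ, F σ) ∪ G := by
    rw [Set.compl_subset_comm]
    intro ω hω u w
    simp only [Set.compl_union, Set.mem_inter_iff, Set.mem_compl_iff, Set.mem_iUnion, not_exists]
      at hω
    obtain ⟨hωF, hωG⟩ := hω
    obtain ⟨σ, hσ1, hσ2⟩ := exists_gridFun_bracket (M := M) hr0 u w
    have hωσ : _ < ((ρ σ + s / 16) * Real.exp (s / 16)) ^ n := not_le.1 (hωF σ)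
    simp only [G, Set.mem_ofPred_eq, not_le] at hωG
    have hωG' := (abs_lt.1 hωG).2
    have hmean := dataMean_gridFun_le hf ht hM u w hσ2
    have hmM : (m : ℝ) / M = 1 / r := by
      rw [hM_def]; push_cast; field_simp
    set d := sample X Y n ω
    set D := l1Dist (stepFun u w) f
    have hq : ∀ k, 0 < truncLik f t (d k) := fun k => truncLik_pos ht _
    have hlog := dataMean_log_truncLik_le hf ht ht1
    have hprodq : ∏ k, truncLik f t (d k) ≤ Real.exp (n * (-entropy f + s / 2)) := by
      rw [← Real.log_le_iff_le_exp (Finset.prod_pos fun k _ => hq k),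
        Real.log_prod fun k _ => (hq k).ne']
      nlinarith
    -- Rounding and the cells with split points cost `2 / r ≤ s / 16` each, the two slacks in `F`
    -- another `s / 16` each: `s / 4` in all.
    have hbase : (ρ σ + s / 16) * Real.exp (s / 16) ≤ Real.exp (s / 4 - D ^ 2 / 4) := by
      calc _ ≤ Real.exp (3 * s / 16 - D ^ 2 / 4) * Real.exp (s / 16) := by
            gcongr
            have h1 := Real.add_one_le_exp (3 * s / 16 - D ^ 2 / 4)
            have h2 : ρ σ ≤ 1 - D ^ 2 / 4 + s / 16 + s / 16 := by
              rw [hmM] at hmean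
              have : 2 * (1 / (r : ℝ)) = 2 / r := by ring
              change ρ σ ≤ _ at hmean
              linarith
            linarith
        _ = _ := by rw [← Real.exp_add]; congr 1; ring
    have hV : ∏ k, gridFun σ (d k) / √(truncLik f t (d k)) ≤
        Real.exp (n * (s / 4 - D ^ 2 / 4)) := by
      rw [Real.exp_nat_mul]
      refine hωσ.le.trans (pow_le_pow_left₀ ?_ hbase n)
      exact mul_nonneg (add_nonneg (hρ0 σ) (by positivity)) (Real.exp_pos _).le
    rw [likelihood_eq_prod]
    calc ∏ k, bern (stepFun u w (d k).1) (d k).2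
        ≤ ∏ k, (gridFun σ (d k) / √(truncLik f t (d k))) ^ 2 * truncLik f t (d k) := by
          refine Finset.prod_le_prod (fun _ _ => bern_nonneg _ _) fun k _ => ?_
          rw [div_pow, Real.sq_sqrt (hq k).le, div_mul_cancel₀ _ (hq k).ne']
          exact (Real.sqrt_le_left (gridFun_nonneg _ _)).1 (hσ1 (d k))
      _ = (∏ k, gridFun σ (d k) / √(truncLik f t (d k))) ^ 2 * ∏ k, truncLik f t (d k) := by
          rw [Finset.prod_mul_distrib, Finset.prod_pow]
      _ ≤ Real.exp (n * (s / 4 - D ^ 2 / 4)) ^ 2 * Real.exp (n * (-entropy f + s / 2)) := by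
          gcongr
          · exact Finset.prod_nonneg fun k _ => (hq k).le
          · exact Finset.prod_nonneg fun k _ =>
              div_nonneg (gridFun_nonneg _ _) (Real.sqrt_nonneg _)
      _ = Real.exp (n * (-entropy f + s - D ^ 2 / 2)) := by
          rw [← Real.exp_nat_mul, ← Real.exp_add]
          congr 1
          push_cast
          ring
  calc _ ≤ P ((⋃ σ, F σ) ∪ G) := measure_mono hsub
    _ ≤ ENNReal.ofReal (s / 2) + ENNReal.ofReal (s / 2) :=
        (measure_union_le _ _).trans (add_le_add hF hG)
    _ = ENNReal.ofReal s := by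
        rw [← ENNReal.ofReal_add (by positivity) (by positivity), add_halves]

end

/-! ### Continuous approximation in cross entropy -/

section

variable {f : unitInterval → unitInterval}

/-- Continuous functions are dense in `L¹`, and clipping to `[0,1]` does not increase the distance
to the `[0,1]`-valued `f`. -/
lemma exists_continuous_l1Dist_le (hf : Measurable f) {e : ℝ} (he : 0 < e) :
    ∃ φ : unitInterval → unitInterval, Continuous φ ∧ l1Dist φ f ≤ e := by
  have hfm : Measurable fun x => (f x : ℝ) := measurable_subtype_coe.comp hf
  have hI : Integrable fun x => (f x : ℝ) := integrable_of_abs_le (B := 1) hfm fun x => by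
    rw [abs_of_nonneg (f x).2.1]; exact (f x).2.2
  obtain ⟨ψ, hψ, hψI⟩ := hI.exists_boundedContinuous_integral_sub_le he
  have hφ : Continuous fun x => Set.projIcc (0 : ℝ) 1 zero_le_one (ψ x) :=
    continuous_projIcc.comp ψ.continuous
  refine ⟨_, hφ, le_trans (integral_mono_of_nonneg (.of_forall fun x => abs_nonneg _)
    (hI.sub hψI).norm (.of_forall fun x => ?_)) hψ⟩
  simp only [Pi.sub_apply, Real.norm_eq_abs, Set.coe_projIcc]
  rw [abs_sub_comm (f x : ℝ), abs_le]
  have h0 := (f x).2.1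
  have h1 := (f x).2.2
  have h2 := neg_abs_le (ψ x - (f x : ℝ))
  have h3 := le_abs_self (ψ x - (f x : ℝ))
  have h4 := abs_nonneg (ψ x - (f x : ℝ))
  constructor
  · rcases le_total 1 (ψ x) with h | h
    · rw [min_eq_left h, max_eq_right zero_le_one]; linarith
    · rw [min_eq_right h]; linarith [le_max_right 0 (ψ x)]
  · rcases le_total 0 (ψ x) with h | h
    · rw [sub_le_iff_le_add]
      exact max_le (by linarith) ((min_le_right _ _).trans (by linarith))
    · rw [max_eq_left ((min_le_right _ _).trans h)]; linarith

lemma log_le_log_add_abs_div {a b η : ℝ} (hη : 0 < η) (ha : 0 < a) (hb : η ≤ b) :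
    Real.log a ≤ Real.log b + |a - b| / η := by
  have hb0 : 0 < b := hη.trans_le hb
  have h1 : Real.log (a / b) ≤ a / b - 1 := Real.log_le_sub_one_of_pos (by positivity)
  rw [Real.log_div ha.ne' hb0.ne'] at h1
  have h2 : a / b - 1 = (a - b) / b := by field_simp
  have h3 : (a - b) / b ≤ |a - b| / η := by
    calc _ ≤ |a - b| / b := by gcongr; exact le_abs_self _
      _ ≤ _ := by gcongr
  linarith

/-- Cross entropy bound for the mixture `(1 - 2 η) q + η`. -/
lemma neg_negMulLog_le_mul_log {p q η e : ℝ} (hη : 0 < η) (he : 1 - 2 * η = Real.exp (-e))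
    (hp : 0 ≤ p) (hq : 0 ≤ q) :
    -Real.negMulLog p - p * (e + |q - p| / η) ≤ p * Real.log ((1 - 2 * η) * q + η) := by
  rcases hp.eq_or_lt with rfl | hp
  · simp
  have hx : 0 < Real.exp (-e) := Real.exp_pos _
  have hx1 : Real.exp (-e) ≤ 1 := by linarith
  have h1 : Real.log ((1 - 2 * η) * p + η) ≤ Real.log ((1 - 2 * η) * q + η) +
      |((1 - 2 * η) * p + η) - ((1 - 2 * η) * q + η)| / η := by
    refine log_le_log_add_abs_div hη ?_ ?_ <;> rw [he] <;> nlinarith [mul_pos hx hp, mul_nonneg hx.le hq]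
  have h2 : |((1 - 2 * η) * p + η) - ((1 - 2 * η) * q + η)| ≤ |q - p| := by
    have : ((1 - 2 * η) * p + η) - ((1 - 2 * η) * q + η) = -(Real.exp (-e) * (q - p)) := by
      rw [he]; ring
    rw [this, abs_neg, abs_mul, abs_of_pos hx]
    exact mul_le_of_le_one_left (abs_nonneg _) hx1
  have h3 : |((1 - 2 * η) * p + η) - ((1 - 2 * η) * q + η)| / η ≤ |q - p| / η := by gcongr
  -- Two losses add up: replacing `q` by `p` costs `|q - p| / η`, as the mixture is at least `η`,
  -- and shrinking `p` by the factor `exp (-e)` costs `e`.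
  have h4 : -e + Real.log p ≤ Real.log ((1 - 2 * η) * p + η) := by
    have hlog := Real.log_mul hx.ne' hp.ne'
    rw [Real.log_exp] at hlog
    rw [← hlog, he]
    exact Real.log_le_log (by positivity) (by linarith)
  have h5 : p * (-e + Real.log p - |q - p| / η) ≤ p * Real.log ((1 - 2 * η) * q + η) := by
    gcongr
    linarith
  rw [Real.negMulLog]
  linarith

/-- A continuous function with values bounded away from `0` and `1` whose expected log-likelihood
is nearly that of `f`. -/
lemma exists_continuous_dataMean_log_ge (hf : Measurable f) {e : ℝ} (he : 0 < e) :
    ∃ g : unitInterval → unitInterval, Continuous g ∧ ∃ η : ℝ, 0 < η ∧ η < 1 ∧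
      (∀ x b, η ≤ bern (g x) b) ∧
      -entropy f - 2 * e ≤ dataMean f fun z => Real.log (bern (g z.1) z.2) := by
  have hx1 : Real.exp (-e) < 1 := Real.exp_lt_one_iff.2 (by linarith)
  have hx0 := Real.exp_pos (-e)
  obtain ⟨η, hηe⟩ : ∃ η : ℝ, 1 - 2 * η = Real.exp (-e) := ⟨(1 - Real.exp (-e)) / 2, by ring⟩
  have hη : 0 < η := by linarith
  -- The accuracy `e * η` offsets the Lipschitz constant `1 / η` of the logarithm on `[η, 1]`.
  obtain ⟨φ, hφ, hφf⟩ := exists_continuous_l1Dist_le hf (mul_pos he hη)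
  have hmem : ∀ x, (1 - 2 * η) * (φ x : ℝ) + η ∈ Set.Icc (0 : ℝ) 1 := fun x => by
    have h0 := (φ x).2.1
    have h1 := (φ x).2.2
    constructor <;> nlinarith
  let g : unitInterval → unitInterval := fun x => ⟨(1 - 2 * η) * (φ x : ℝ) + η, hmem x⟩
  have hg : Continuous g := by fun_prop
  have hgb : ∀ x b, bern (g x) b = (1 - 2 * η) * bern (φ x) b + η := by
    intro x b
    cases b <;> simp [g]
    ring
  have hgη : ∀ x b, η ≤ bern (g x) b := fun x b => by
    rw [hgb, hηe]
    nlinarith [mul_nonneg hx0.le (bern_nonneg (φ x) b)]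
  have hη1 : η < 1 := by linarith
  refine ⟨g, hg, η, hη, hη1, hgη, ?_⟩
  have hI := integrable_binEntropy hf
  have hdI : Integrable fun x => |(φ x : ℝ) - f x| :=
    integrable_of_abs_le (B := 1)
      ((measurable_subtype_coe.comp hφ.measurable).sub (measurable_subtype_coe.comp hf)).abs
      fun x => by
        rw [abs_abs, abs_le]
        constructor <;> linarith [(φ x).2.1, (φ x).2.2, (f x).2.1, (f x).2.2]
  have hlogm : Measurable fun z : unitInterval × Bool => Real.log (bern (g z.1) z.2) :=
    measurable_of_bool_slices fun b => (measurable_bern_comp hg.measurable b).log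
  have hlogB : ∀ z : unitInterval × Bool, |Real.log (bern (g z.1) z.2)| ≤ -Real.log η := by
    intro z
    rw [abs_of_nonpos (Real.log_nonpos (bern_nonneg _ _) (bern_le_one _ _))]
    exact neg_le_neg (Real.log_le_log hη (hgη _ _))
  calc -entropy f - 2 * e ≤ -entropy f - (e + l1Dist φ f / η) := by
        have : l1Dist φ f / η ≤ e := (div_le_iff₀ hη).2 hφf
        linarith
    _ = ∫ x, (-Real.binEntropy (f x : ℝ) - (e + |(φ x : ℝ) - f x| / η)) := by
        rw [integral_sub (f := fun x => -Real.binEntropy (f x : ℝ))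
            (g := fun x => e + |(φ x : ℝ) - f x| / η) hI.neg
            ((integrable_const _).add (hdI.div_const _)), integral_neg,
          integral_add (integrable_const _) (hdI.div_const _), integral_div]
        simp [entropy, l1Dist]
    _ ≤ _ := by
        refine integral_mono (hI.neg.sub ((integrable_const _).add (hdI.div_const _)))
          (integrable_dataMean hf hlogm hlogB) fun x => ?_
        have h1 := neg_negMulLog_le_mul_log hη hηe (bern_nonneg (f x) true)
          (bern_nonneg (φ x) true)
        have h2 := neg_negMulLog_le_mul_log hη hηe (bern_nonneg (f x) false)
          (bern_nonneg (φ x) false)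
        simp only [hgb]
        rw [Real.binEntropy_eq_negMulLog_add_negMulLog_one_sub]
        simp only [bern_true, bern_false] at *
        have h3 : |1 - (φ x : ℝ) - (1 - (f x : ℝ))| = |(φ x : ℝ) - f x| := by
          rw [abs_sub_comm]; congr 1; ring
        rw [h3] at h2
        linarith

end

/-! ### Prior mass near a continuous function and the lower bound on the predictive probability -/

/-- The split point vectors whose `i`-th entry, for each `i < L`, lies in `[i / L, (i + 1) / L]`. -/
def splitBox (L m : ℕ) : Set (Fin m → unitInterval) :=
  Set.pi Set.univ fun i => {x | (i : ℕ) < L → ((i : ℕ) : ℝ) / L ≤ x ∧ (x : ℝ) ≤ ((i : ℕ) + 1) / L}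

lemma measurableSet_splitBox (L m : ℕ) : MeasurableSet (splitBox L m) := by
  refine MeasurableSet.univ_pi fun i => ?_
  by_cases h : (i : ℕ) < L
  · simp only [h, forall_const]
    exact (measurableSet_le measurable_const measurable_subtype_coe).inter
      (measurableSet_le measurable_subtype_coe measurable_const)
  · simp [h]

/-- At most `L` coordinates are constrained, each to an interval of length `1 / L`, so the bound
does not deteriorate as `m` grows. -/
lemma volume_splitBox_ge {L : ℕ} (hL : 0 < L) (m : ℕ) :
    (1 / (L : ℝ)) ^ L ≤ volume.real (splitBox L m) := by
  have hL' : (0 : ℝ) < L := Nat.cast_pos.2 hL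
  have hi : ∀ i : Fin m, (if (i : ℕ) < L then 1 / (L : ℝ) else 1) = volume.real
      {x : unitInterval | (i : ℕ) < L → ((i : ℕ) : ℝ) / L ≤ x ∧ (x : ℝ) ≤ ((i : ℕ) + 1) / L} := by
    intro i
    split_ifs with h
    · have h' : ((i : ℕ) : ℝ) + 1 ≤ L := by exact_mod_cast h
      have ha : ((i : ℕ) : ℝ) / L ∈ Set.Icc (0 : ℝ) 1 :=
        ⟨by positivity, (div_le_one hL').2 (by linarith)⟩
      have hb : (((i : ℕ) : ℝ) + 1) / L ∈ Set.Icc (0 : ℝ) 1 :=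
        ⟨by positivity, (div_le_one hL').2 h'⟩
      have : {x : unitInterval | (i : ℕ) < L → ((i : ℕ) : ℝ) / L ≤ x ∧
          (x : ℝ) ≤ ((i : ℕ) + 1) / L} = Set.Icc ⟨_, ha⟩ ⟨_, hb⟩ := by
        ext x
        simp only [h, forall_const]
        rfl
      rw [this, Measure.real, unitInterval.volume_Icc, ENNReal.toReal_ofReal]
      · simp only; ring
      · simp only [← sub_div]; exact div_nonneg (by linarith) hL'.le
    · simp [h]
  rw [Measure.real, splitBox, volume_pi_pi, ENNReal.toReal_prod]
  change _ ≤ ∏ i : Fin m, volume.real _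
  rw [← Finset.prod_congr rfl fun i _ => hi i, Finset.prod_ite, Finset.prod_const_one, mul_one,
    Finset.prod_const]
  refine pow_le_pow_of_le_one (by positivity) ?_ ?_
  · rw [div_le_one hL']; exact_mod_cast hL
  · rw [Fin.card_filter_val_lt]
    exact min_le_right _ _

lemma cellIndex_lt_of_le_of_lt {m : ℕ} {u : Fin m → unitInterval} {x y : unitInterval} (i : Fin m)
    (hx : x ≤ u i) (hy : u i < y) : cellIndex u x < cellIndex u y := by
  refine Fin.mk_lt_mk.2 (Finset.card_lt_card (Finset.ssubset_iff_of_subset ?_ |>.2 ⟨i, ?_⟩))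
  · exact Finset.monotone_filter_right _ fun j _ hj => lt_trans hj (hx.trans_lt hy)
  · simp [hx, hy]

/-- If `y - x > 2 / L`, the interval `[j / L, (j + 1) / L]` with `j = ⌈x L⌉` fits between `x` and
`y`, and its split point separates them. -/
lemma sub_le_of_cellIndex_eq {L m : ℕ} (hL : 0 < L) (hLm : L ≤ m) {u : Fin m → unitInterval}
    (hu : u ∈ splitBox L m) {x y : unitInterval} (hxy : cellIndex u x = cellIndex u y) :
    (y : ℝ) - x ≤ 2 / L := by
  by_contra! h
  have hL' : (0 : ℝ) < L := Nat.cast_pos.2 hL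
  set j := ⌈(x : ℝ) * L⌉₊
  have hxL : 0 ≤ (x : ℝ) * L := mul_nonneg x.2.1 hL'.le
  have hj1 : (x : ℝ) * L ≤ j := Nat.le_ceil _
  have hj2 : (j : ℝ) < x * L + 1 := Nat.ceil_lt_add_one hxL
  have hy : (x : ℝ) * L + 2 < (y : ℝ) * L := by
    rw [div_lt_iff₀ hL'] at h
    linarith
  have hyL : (y : ℝ) * L ≤ L := mul_le_of_le_one_left hL'.le y.2.2
  have hjL : j < L := by
    have : (j : ℝ) < L := by linarith
    exact_mod_cast this
  obtain ⟨h1, h2⟩ := hu ⟨j, hjL.trans_le hLm⟩ (Set.mem_univ _) hjL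
  simp only at h1 h2
  rw [div_le_iff₀ hL'] at h1
  rw [le_div_iff₀ hL'] at h2
  refine (cellIndex_lt_of_le_of_lt (u := u) (x := x) (y := y) ⟨j, hjL.trans_le hLm⟩ ?_ ?_).ne hxy
  · exact Subtype.coe_le_coe.1 (le_of_mul_le_mul_right (hj1.trans h1) hL')
  · exact Subtype.coe_lt_coe.1 (lt_of_mul_lt_mul_right (by linarith) hL'.le)

lemma exists_stepFun_box {L m : ℕ} (hL : 0 < L) (hLm : L ≤ m) {u : Fin m → unitInterval}
    (hu : u ∈ splitBox L m) {g : unitInterval → unitInterval} {κ : ℝ} (hκ : 0 ≤ κ)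
    (hgκ : ∀ x, κ ≤ g x)
    (hg : ∀ x y : unitInterval, |(x : ℝ) - y| ≤ 2 / L → |(g x : ℝ) - g y| ≤ κ) :
    ∃ W : Set (Fin (m + 1) → unitInterval), MeasurableSet W ∧ volume.real W = κ ^ (m + 1) ∧
      ∀ w ∈ W, ∀ x, |(stepFun u w x : ℝ) - g x| ≤ 2 * κ := by
  -- Empty cells get an arbitrary point: their heights do not matter, and constraining them too
  -- makes the volume exactly `κ ^ (m + 1)`.
  let c : Fin (m + 1) → unitInterval := Function.invFun (cellIndex u)
  have hc : ∀ x, cellIndex u (c (cellIndex u x)) = cellIndex u x := fun x =>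
    Function.invFun_eq ⟨x, rfl⟩
  have hmem : ∀ i, (g (c i) : ℝ) - κ ∈ Set.Icc (0 : ℝ) 1 := fun i =>
    ⟨by linarith [hgκ (c i)], by linarith [(g (c i)).2.2]⟩
  -- The intervals extend only below `g (c i)`: with `κ ≤ g` they stay inside `[0,1]` at full length
  -- `κ`.
  refine ⟨Set.pi Set.univ fun i => Set.Icc ⟨_, hmem i⟩ (g (c i)),
    MeasurableSet.univ_pi fun i => measurableSet_Icc, ?_, fun w hw x => ?_⟩
  · rw [Measure.real, volume_pi_pi, ENNReal.toReal_prod]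
    simp [unitInterval.volume_Icc, hκ]
  · obtain ⟨h1, h2⟩ := hw (cellIndex u x) (Set.mem_univ _)
    have h1' : (g (c (cellIndex u x)) : ℝ) - κ ≤ w (cellIndex u x) := h1
    have h2' : (w (cellIndex u x) : ℝ) ≤ g (c (cellIndex u x)) := h2
    have h3 := abs_le.1 <| hg (c (cellIndex u x)) x <| abs_le.2
      ⟨by linarith [sub_le_of_cellIndex_eq hL hLm hu (hc x)],
        sub_le_of_cellIndex_eq hL hLm hu (hc x).symm⟩
    rw [stepFun, abs_le]
    constructor <;> linarith

lemma measureReal_mul_le_integral {α : Type*} [MeasurableSpace α] {μ : Measure α}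
    [IsFiniteMeasure μ] {h : α → ℝ} (hh : Integrable h μ) (h0 : ∀ x, 0 ≤ h x) {W : Set α}
    (hW : MeasurableSet W) {b : ℝ} (hb : ∀ x ∈ W, b ≤ h x) : μ.real W * b ≤ ∫ x, h x ∂μ := by
  calc μ.real W * b = ∫ x in W, b ∂μ := by simp
    _ ≤ ∫ x in W, h x ∂μ := setIntegral_mono_on (integrable_const _).integrableOn
        hh.integrableOn hW hb
    _ ≤ ∫ x, h x ∂μ := setIntegral_le_integral hh (.of_forall h0)

/-- With high probability the predictive probability of the data is nearly `exp (-n H(f))` or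
larger. -/
theorem exists_predictive_ge {f : unitInterval → unitInterval} (hf : Measurable f) {s : ℝ}
    (hs : 0 < s) :
    ∃ ε : ℝ, 0 < ε ∧ ∃ K : ℕ, ∃ n₀ : ℕ, ∀ n : ℕ, n₀ ≤ n → ∀ m : ℕ, K ≤ m → (m : ℝ) ≤ ε * n →
      ∀ {Ω : Type*} [MeasurableSpace Ω] (P : Measure Ω) [IsProbabilityMeasure P]
        (X : ℕ → Ω → unitInterval) (Y : ℕ → Ω → Bool), IsDataStream P f X Y →
        P {ω | Real.exp (-(n * (entropy f + s))) ≤ predictive m (sample X Y n ω)}ᶜ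
          ≤ ENNReal.ofReal s := by
  -- Budget per observation: `2 * e` for replacing `f` by `g`, and `e` each for the deviation of the
  -- log-likelihood, the heights differing from `g`, the mass of the split box and the mass of the
  -- height box.
  obtain ⟨e, rfl⟩ : ∃ e, s = 6 * e := ⟨s / 6, by ring⟩
  have he : 0 < e := by linarith
  obtain ⟨g, hg, η, hη, hη1, hgη, hmean⟩ := exists_continuous_dataMean_log_ge hf he
  have hx1 : Real.exp (-e) < 1 := Real.exp_lt_one_iff.2 (by linarith)
  have hx0 := Real.exp_pos (-e)
  -- Chosen so that `b - 2 * κ ≥ exp (-e) * b` whenever `b ≥ η`.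
  obtain ⟨κ, hκ⟩ : ∃ κ : ℝ, 2 * κ = (1 - Real.exp (-e)) * η :=
    ⟨(1 - Real.exp (-e)) * η / 2, by ring⟩
  have hκ0 : 0 < κ := by nlinarith
  have hκη : κ ≤ η := by nlinarith
  have hκ1 : κ < 1 := by linarith
  have hgu : UniformContinuous fun x => (g x : ℝ) :=
    CompactSpace.uniformContinuous_of_continuous (by fun_prop)
  obtain ⟨γ, hγ, hgγ⟩ := Metric.uniformContinuous_iff.1 hgu κ hκ0
  obtain ⟨L, hLγ⟩ := exists_nat_gt (2 / γ)
  have hL' : (0 : ℝ) < L := lt_trans (by positivity) hLγ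
  have hL : 0 < L := Nat.cast_pos.1 hL'
  have hosc : ∀ x y : unitInterval, |(x : ℝ) - y| ≤ 2 / L → |(g x : ℝ) - g y| ≤ κ := by
    intro x y hxy
    refine (hgγ (a := x) (b := y) ?_).le
    refine lt_of_le_of_lt hxy ?_
    rw [div_lt_iff₀ hγ] at hLγ
    rw [div_lt_iff₀ hL']
    linarith
  set lam := -Real.log κ with hlam_def
  have hlam : 0 < lam := neg_pos.2 (Real.log_neg hκ0 hκ1)
  obtain ⟨n₁, hn₁⟩ := exists_nat_gt (L * Real.log L / e)
  obtain ⟨n₂, hn₂⟩ := exists_nat_gt ((-Real.log η) ^ 2 / ((6 * e) * e ^ 2))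
  -- `K = L` supplies a split point for each of the `L` intervals; this `ε` and `m + 1 ≤ 2 * m` give
  -- `(m + 1) * lam ≤ n * e`.
  refine ⟨e / (2 * lam), by positivity, L, max 1 (max n₁ n₂),
    fun n hn m hm hmn Ω _ P _ X Y hD => ?_⟩
  have hn0 : 0 < n := lt_of_lt_of_le one_pos ((le_max_left _ _).trans hn)
  have hn0' : (0 : ℝ) < n := Nat.cast_pos.2 hn0
  have hn1 : (n₁ : ℝ) ≤ n := Nat.cast_le.2 ((le_max_left _ _).trans ((le_max_right _ _).trans hn))
  have hn2 : (n₂ : ℝ) ≤ n := Nat.cast_le.2 ((le_max_right _ _).trans ((le_max_right _ _).trans hn))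
  have hm1 : (1 : ℝ) ≤ m := Nat.one_le_cast.2 (hL.trans_le hm)
  have hlogm : Measurable fun z : unitInterval × Bool => Real.log (bern (g z.1) z.2) :=
    measurable_of_bool_slices fun b => (measurable_bern_comp hg.measurable b).log
  have hlogB : ∀ z : unitInterval × Bool, |Real.log (bern (g z.1) z.2)| ≤ -Real.log η := by
    intro z
    rw [abs_of_nonpos (Real.log_nonpos (bern_nonneg _ _) (bern_le_one _ _))]
    exact neg_le_neg (Real.log_le_log hη (hgη _ _))
  refine (measure_mono ?_).trans ((hD.prob_deviation_le hf hlogm hlogB he hn0).trans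
    (ENNReal.ofReal_le_ofReal ?_))
  swap
  · rw [div_lt_iff₀ (by positivity)] at hn₂
    rw [div_le_iff₀ (by positivity)]
    have : (n₂ : ℝ) * (6 * e * e ^ 2) ≤ n * (6 * e * e ^ 2) := by gcongr
    linarith
  rw [Set.compl_subset_comm]
  intro ω hω
  simp only [Set.mem_compl_iff, Set.mem_ofPred_eq, not_le] at hω ⊢
  have hω' := (abs_lt.1 hω).1
  set d := sample X Y n ω
  set S := ∑ k, Real.log (bern (g (d k).1) (d k).2) with hS
  have hb0 : ∀ x b, 0 < bern (g x) b := fun x b => hη.trans_le (hgη x b)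
  have hlik : ∀ u ∈ splitBox L m, κ ^ (m + 1) * Real.exp (S - n * e) ≤ splitPredictive u d := by
    intro u hu
    obtain ⟨W, hW, hWv, hWg⟩ := exists_stepFun_box hL hm hu hκ0.le
      (fun x => hκη.trans (by simpa using hgη x true)) hosc
    rw [← hWv]
    refine measureReal_mul_le_integral (integrable_likelihood u d) (likelihood_nonneg u d) hW
      fun w hw => ?_
    have hprod : Real.exp (S - n * e) = ∏ k, Real.exp (-e) * bern (g (d k).1) (d k).2 := by
      rw [Finset.prod_mul_distrib, Finset.prod_const, Finset.card_univ, Fintype.card_fin,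
        ← Real.exp_nat_mul, sub_eq_add_neg, add_comm, Real.exp_add, hS, Real.exp_sum,
        Finset.prod_congr rfl fun k _ => Real.exp_log (hb0 (d k).1 (d k).2)]
      congr 2
      ring
    rw [likelihood_eq_prod, hprod]
    refine Finset.prod_le_prod (fun k _ => (mul_pos hx0 (hb0 _ _)).le) fun k _ => ?_
    have h1 := abs_le.1 (hWg w hw (d k).1)
    have h2 : bern (g (d k).1) (d k).2 - 2 * κ ≤ bern (stepFun u w (d k).1) (d k).2 := by
      cases (d k).2 <;> simp <;> linarith
    have h3 := hgη (d k).1 (d k).2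
    nlinarith
  have hpred : (1 / (L : ℝ)) ^ L * (κ ^ (m + 1) * Real.exp (S - n * e)) ≤ predictive m d := by
    refine le_trans ?_ (measureReal_mul_le_integral (integrable_splitPredictive d)
      (fun u => splitPredictive_nonneg u d) (measurableSet_splitBox L m) hlik)
    gcongr
    exact volume_splitBox_ge hL m
  refine le_trans ?_ hpred
  have e1 : (1 / (L : ℝ)) ^ L = Real.exp (-(L * Real.log L)) := by
    rw [one_div, inv_pow, Real.exp_neg, Real.exp_nat_mul, Real.exp_log hL']
  have e2 : κ ^ (m + 1) = Real.exp (-((m + 1) * lam)) := by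
    have : -((m + 1) * lam) = ((m + 1 : ℕ) : ℝ) * Real.log κ := by
      rw [hlam_def]; push_cast; ring
    rw [this, Real.exp_nat_mul, Real.exp_log hκ0]
  rw [e1, e2, ← Real.exp_add, ← Real.exp_add, Real.exp_le_exp]
  have h1 : (L : ℝ) * Real.log L ≤ n * e := by
    rw [div_lt_iff₀ he] at hn₁
    nlinarith
  have h2 : ((m : ℝ) + 1) * lam ≤ n * e := by
    calc ((m : ℝ) + 1) * lam ≤ (2 * m) * lam := by gcongr; linarith
      _ ≤ (2 * (e / (2 * lam) * n)) * lam := by gcongr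
      _ = n * e := by field_simp
  have h3 : (n : ℝ) * (-entropy f - 2 * e) ≤
      n * dataMean f fun z => Real.log (bern (g z.1) z.2) := by gcongr
  linarith

end BinaryRegression

/-! ### Combination of the two bounds -/

theorem corollary4 (f : unitInterval → unitInterval) (hf : Measurable f) (δ : ℝ) (hδ : 0 < δ) :
    ∃ ε : ℝ, 0 < ε ∧ ∃ K : ℕ, ∃ n₀ : ℕ, ∀ n : ℕ, n₀ ≤ n → ∀ m : ℕ, K ≤ m → (m : ℝ) ≤ ε * n →
      ∀ {Ω : Type*} [MeasurableSpace Ω] (P : Measure Ω) [IsProbabilityMeasure P]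
        (X : ℕ → Ω → unitInterval) (Y : ℕ → Ω → Bool), BinaryRegression.IsDataStream P f X Y →
        ENNReal.ofReal (1 - δ) ≤ P {ω |
          BinaryRegression.posteriorMass m (BinaryRegression.sample X Y n ω)
              {g | δ ≤ BinaryRegression.l1Dist g f} < ENNReal.ofReal δ ∧
          |(n : ℝ)⁻¹ * Real.log (BinaryRegression.predictive m (BinaryRegression.sample X Y n ω))
              + BinaryRegression.entropy f| < δ} := by
  -- `s ≤ δ / 3` makes the failure probability `2 * s` at most `δ` and the error `s` in the
  -- log-predictive less than `δ`; `s ≤ δ ^ 2 / 8` makes the posterior exponent `2 * s - δ ^ 2 / 2`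
  -- at most `-δ ^ 2 / 4`.
  set s := min (δ / 3) (δ ^ 2 / 8) with hs_def
  have hs : 0 < s := lt_min (by positivity) (by positivity)
  have hs1 : s ≤ δ / 3 := min_le_left _ _
  have hs2 : s ≤ δ ^ 2 / 8 := min_le_right _ _
  obtain ⟨ε₁, hε₁, n₁, hup⟩ := BinaryRegression.exists_likelihood_bound hf hs
  obtain ⟨ε₂, hε₂, K, n₂, hlow⟩ := BinaryRegression.exists_predictive_ge hf hs
  obtain ⟨n₃, hn₃⟩ := exists_nat_gt (-Real.log δ / (δ ^ 2 / 4))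
  refine ⟨min ε₁ ε₂, lt_min hε₁ hε₂, max 1 K, max (max 1 n₃) (max n₁ n₂),
    fun n hn m hm hmn Ω _ P _ X Y hD => ?_⟩
  simp only [max_le_iff] at hn hm
  obtain ⟨⟨hn0, hn3⟩, hn1, hn2⟩ := hn
  have hn0' : (0 : ℝ) < n := Nat.cast_pos.2 hn0
  have hn3' : (n₃ : ℝ) ≤ n := Nat.cast_le.2 hn3
  have hU := hup n hn1 m hm.1 (hmn.trans (by gcongr; exact min_le_left _ _)) P X Y hD
  have hL := hlow n hn2 m hm.2 (hmn.trans (by gcongr; exact min_le_right _ _)) P X Y hD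
  set U : Set Ω := {ω | ∀ (u : Fin m → unitInterval) w,
    BinaryRegression.likelihood u (BinaryRegression.sample X Y n ω) w ≤
      Real.exp (n * (-BinaryRegression.entropy f + s -
        BinaryRegression.l1Dist (BinaryRegression.stepFun u w) f ^ 2 / 2))}
  set V : Set Ω := {ω | Real.exp (-(n * (BinaryRegression.entropy f + s))) ≤
    BinaryRegression.predictive m (BinaryRegression.sample X Y n ω)}
  have hprob : ENNReal.ofReal (1 - δ) ≤ P (U ∩ V) := by
    have h1 : P (U ∩ V)ᶜ ≤ ENNReal.ofReal δ := by
      rw [Set.compl_inter]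
      refine (measure_union_le _ _).trans ((add_le_add hU hL).trans ?_)
      rw [← ENNReal.ofReal_add hs.le hs.le]
      exact ENNReal.ofReal_le_ofReal (by linarith)
    have h2 : 1 ≤ P (U ∩ V) + ENNReal.ofReal δ := by
      calc (1 : ENNReal) = P ((U ∩ V) ∪ (U ∩ V)ᶜ) := by rw [Set.union_compl_self, measure_univ]
        _ ≤ P (U ∩ V) + P (U ∩ V)ᶜ := measure_union_le _ _
        _ ≤ _ := by gcongr
    rw [ENNReal.ofReal_sub _ hδ.le, ENNReal.ofReal_one]
    exact tsub_le_iff_right.2 h2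
  refine hprob.trans (measure_mono ?_)
  rintro ω ⟨hωU, hωV⟩
  set d := BinaryRegression.sample X Y n ω
  set H := BinaryRegression.entropy f
  have hωV' : Real.exp (-(n * (H + s))) ≤ BinaryRegression.predictive m d := hωV
  have hZ : 0 < BinaryRegression.predictive m d := (Real.exp_pos _).trans_le hωV'
  have hZle : BinaryRegression.predictive m d ≤ Real.exp (n * (-H + s)) := by
    refine BinaryRegression.predictive_le fun u w => (hωU u w).trans ?_
    gcongr
    linarith [sq_nonneg (BinaryRegression.l1Dist (BinaryRegression.stepFun u w) f)]
  constructor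
  · refine (BinaryRegression.posteriorMass_le (B := Real.exp (n * (-H + s - δ ^ 2 / 2)))
      fun u w hw => (hωU u w).trans ?_).trans_lt ?_
    · have hw' : δ ≤ BinaryRegression.l1Dist (BinaryRegression.stepFun u w) f := hw
      gcongr
    · rw [← ENNReal.ofReal_div_of_pos hZ, ENNReal.ofReal_lt_ofReal_iff hδ, div_lt_iff₀ hZ]
      have h1 : -Real.log δ < n * (δ ^ 2 / 4) := by
        rw [div_lt_iff₀ (by positivity)] at hn₃
        nlinarith [sq_nonneg δ]
      calc Real.exp (n * (-H + s - δ ^ 2 / 2))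
          < Real.exp (Real.log δ + -(n * (H + s))) := by
            rw [Real.exp_lt_exp]
            have : n * (2 * s) ≤ n * (δ ^ 2 / 4) := by gcongr; linarith
            linarith
        _ = δ * Real.exp (-(n * (H + s))) := by rw [Real.exp_add, Real.exp_log hδ]
        _ ≤ δ * BinaryRegression.predictive m d := by gcongr
  · have h1 := (Real.le_log_iff_exp_le hZ).2 hωV'
    have h2 := (Real.log_le_iff_le_exp hZ).2 hZle
    have h3 : (n : ℝ)⁻¹ * Real.log (BinaryRegression.predictive m d) ≤ -H + s := by
      rw [inv_mul_le_iff₀ hn0']; exact h2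
    have h4 : -(H + s) ≤ (n : ℝ)⁻¹ * Real.log (BinaryRegression.predictive m d) := by
      rw [le_inv_mul_iff₀ hn0']; linarith
    rw [abs_lt]
    constructor <;> linarith
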